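/- Let $\mathcal H$ be a real Hilbert space, let $m\ge 1$, let $M_1,\dots,M_m$ be closed linear subspaces of $\mathcal H$, and let $T:=P_{M_m}\cdots P_{M_1}$, where $P_K$ denotes the orthogonal projection onto a closed linear subspace $K$. Let $\mathbf H:=\mathcal H^m$ be equipped with the inner product $\langle \mathbf x,\mathbf y\rangle:=\frac1m\sum_{i=1}^m\langle x_i,y_i\rangle$ and the induced norm, and put $$\mathbf C:=M_1\times\cdots\times M_m,\qquad \mathbf D:=\{(x,\dots,x): x\in\mathcal H\},\qquad \mathbf M_i:=M_i\times\cdots\times M_i\ (m\text{ times}),\qquad \mathbf T:=P_{\mathbf M_m}\cdots P_{\mathbf M_1}.$$ Then, with $\|\cdot\|$ denoting the operator norm, as $k\to\infty$: (i) $\|T^k-T^{k-1}\|=O(k^{-1})$; (ii) $\max_{i}\|P_{M_i^\perp}T^k\|=O(k^{-1/2})$; (iii) $\max_{i}\|T^kP_{M_i^\perp}\|=O(k^{-1/2})$; (iv) $\max_{i}\|(T^k-T^{k-1})P_{M_i^\perp}\|=O(k^{-3/2})$; (v) $\max_{i,j}\|P_{M_i^\perp}T^kP_{M_j^\perp}\|=O(k^{-1})$;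 (vi) $\|(\mathbf T^k-\mathbf T^{k-1})P_{\mathbf D}\|=O(k^{-1})$; (vii) $\|P_{\mathbf C^\perp}\mathbf T^kP_{\mathbf D}\|=O(k^{-1/2})$; (viii) $\|\mathbf T^kP_{\mathbf D}P_{\mathbf C^\perp}\|=O(k^{-1/2})$; (ix) $\|(\mathbf T^k-\mathbf T^{k-1})P_{\mathbf D}P_{\mathbf C^\perp}\|=O(k^{-3/2})$; (x) $\|P_{\mathbf C^\perp}\mathbf T^kP_{\mathbf D}P_{\mathbf C^\perp}\|=O(k^{-1})$. -/

import Mathlib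

open Filter Asymptotics

noncomputable section

/-- The orthogonal projection `P_K : E → E` onto a closed linear subspace `K` of a real Hilbert
space, as a bounded operator on the whole space. -/
def orthProj {E : Type*} [NormedAddCommGroup E] [InnerProductSpace ℝ E] [CompleteSpace E]
    (K : ClosedSubmodule ℝ E) : E →L[ℝ] E :=
  K.toSubmodule.starProjection

/-- The product `P_{M_m} ⋯ P_{M_1}`. The list `[P_{M_1}, …, P_{M_m}]` is reversed, so that
`P_{M_1}` is applied first (multiplication of operators is composition). -/
def cyclicProduct {E : Type*} [NormedAddCommGroup E] [InnerProductSpace ℝ E] [CompleteSpace E]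
    {m : ℕ} (M : Fin m → ClosedSubmodule ℝ E) : E →L[ℝ] E :=
  (List.ofFn fun i => orthProj (M i)).reverse.prod

/-- The underlying vector space `H × ⋯ × H` (`m` times) of Pierra's product space. It is a type
synonym, because its norm is not the sup norm of `Fin m → H`. -/
def ProductSpace (m : ℕ) (H : Type*) : Type _ := Fin m → H

namespace ProductSpace

set_option linter.unusedSectionVars false

variable {m : ℕ} {H : Type*} [NormedAddCommGroup H] [InnerProductSpace ℝ H]

instance : AddCommGroup (ProductSpace m H) := inferInstanceAs (AddCommGroup (Fin m → H))

instance : Module ℝ (ProductSpace m H) := inferInstanceAs (Module ℝ (Fin m → H))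

@[simp] theorem zero_apply (i : Fin m) : (0 : ProductSpace m H) i = 0 := rfl

@[simp] theorem add_apply (x y : ProductSpace m H) (i : Fin m) : (x + y) i = x i + y i := rfl

@[simp] theorem sub_apply (x y : ProductSpace m H) (i : Fin m) : (x - y) i = x i - y i := rfl

@[simp] theorem smul_apply (c : ℝ) (x : ProductSpace m H) (i : Fin m) : (c • x) i = c • x i := rfl

/-- The inner product `⟨x, y⟩ = (1/m) ∑ i, ⟨x_i, y_i⟩`. -/
abbrev core : InnerProductSpace.Core ℝ (ProductSpace m H) where
  inner x y := (1 / (m : ℝ)) * ∑ i, inner ℝ (x i) (y i)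
  conj_inner_symm x y := by simp [real_inner_comm]
  re_inner_nonneg x := by
    have : 0 ≤ ∑ i, inner ℝ (x i) (x i) := Finset.sum_nonneg fun i _ => real_inner_self_nonneg
    simp only [RCLike.re_to_real]
    positivity
  add_left x y z := by simp [inner_add_left, Finset.sum_add_distrib, mul_add]
  smul_left x y r := by
    simp only [smul_apply, real_inner_smul_left, ← Finset.mul_sum, conj_trivial]
    ring
  definite x h := by
    funext i
    have hm : (1 / (m : ℝ)) ≠ 0 := by
      have : 0 < m := i.pos
      positivity
    have h' := (mul_eq_zero.mp h).resolve_left hm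
    have h0 := (Finset.sum_eq_zero_iff_of_nonneg
      (f := fun j => inner ℝ (x j) (x j)) fun _ _ => real_inner_self_nonneg).mp h'
    exact inner_self_eq_zero.mp (h0 i (Finset.mem_univ i))

instance : NormedAddCommGroup (ProductSpace m H) :=
  core.toNormedAddCommGroup

instance : InnerProductSpace ℝ (ProductSpace m H) :=
  InnerProductSpace.ofCore core.toCore

theorem inner_def (x y : ProductSpace m H) :
    inner ℝ x y = (1 / (m : ℝ)) * ∑ i, inner ℝ (x i) (y i) := rfl

theorem norm_def (x : ProductSpace m H) : ‖x‖ = √((1 / (m : ℝ)) * ∑ i, ‖x i‖ ^ 2) := by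
  rw [norm_eq_sqrt_real_inner, inner_def]
  simp only [real_inner_self_eq_norm_sq]

theorem norm_apply_le (x : ProductSpace m H) (i : Fin m) : ‖x i‖ ≤ √(m : ℝ) * ‖x‖ := by
  have hm : (0 : ℝ) < m := by exact_mod_cast i.pos
  rw [norm_def, ← Real.sqrt_mul hm.le, ← mul_assoc, mul_one_div_cancel hm.ne', one_mul]
  apply Real.le_sqrt_of_sq_le
  exact Finset.single_le_sum (f := fun i => ‖x i‖ ^ 2) (fun j _ => sq_nonneg _)
    (Finset.mem_univ i)

/-- The coordinate map `x ↦ x_i`. -/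
def coord (i : Fin m) : ProductSpace m H →L[ℝ] H :=
  LinearMap.mkContinuous
    { toFun := fun x => x i, map_add' := fun _ _ => rfl, map_smul' := fun _ _ => rfl }
    (√(m : ℝ)) (fun x => norm_apply_le x i)

@[simp] theorem coord_apply (i : Fin m) (x : ProductSpace m H) : coord i x = x i := rfl

instance [CompleteSpace H] : CompleteSpace (ProductSpace m H) := by
  refine Metric.complete_of_cauchySeq_tendsto fun u hu => ?_
  have hc : ∀ i, ∃ a, Tendsto (fun n => coord i (u n)) atTop (nhds a) := fun i =>
    cauchySeq_tendsto_of_complete (hu.map (coord i).uniformContinuous)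
  choose a ha using hc
  let b : ProductSpace m H := a
  refine ⟨b, tendsto_iff_norm_sub_tendsto_zero.mpr ?_⟩
  simp only [norm_def, sub_apply]
  have h0 : ∀ i, Tendsto (fun n => ‖u n i - b i‖ ^ 2) atTop (nhds 0) := fun i => by
    simpa using (tendsto_iff_norm_sub_tendsto_zero.mp (ha i)).pow 2
  have h1 := (tendsto_finsetSum Finset.univ fun i _ => h0 i).const_mul (1 / (m : ℝ))
  simpa using h1.sqrt

/-- `C = M_1 × ⋯ × M_m`. -/
def subspaceC (M : Fin m → ClosedSubmodule ℝ H) : ClosedSubmodule ℝ (ProductSpace m H) :=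
  ⨅ i, (M i).comap (coord i)

/-- The diagonal `D = {(x, …, x) : x ∈ H}`. -/
def diagonal (m : ℕ) (H : Type*) [NormedAddCommGroup H] [InnerProductSpace ℝ H] :
    ClosedSubmodule ℝ (ProductSpace m H) where
  carrier := {x | ∃ h : H, ∀ i, x i = h}
  zero_mem' := ⟨0, fun _ => rfl⟩
  add_mem' := by
    rintro x y ⟨a, ha⟩ ⟨b, hb⟩
    exact ⟨a + b, fun i => by simp [ha, hb]⟩
  smul_mem' := by
    rintro c x ⟨a, ha⟩
    exact ⟨c • a, fun i => by simp [ha]⟩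
  isClosed' := by
    have : {x : ProductSpace m H | ∃ h : H, ∀ i, x i = h} =
        ⋂ i, ⋂ j, {x | coord i x = coord j x} := by
      ext x
      simp only [Set.mem_ofPred_eq, Set.mem_iInter, coord_apply]
      constructor
      · rintro ⟨h, hh⟩ i j
        rw [hh i, hh j]
      · intro hx
        rcases isEmpty_or_nonempty (Fin m) with he | ⟨⟨i⟩⟩
        · exact ⟨0, fun i => he.elim i⟩
        · exact ⟨x i, fun j => hx j i⟩
    change IsClosed {x : ProductSpace m H | ∃ h : H, ∀ i, x i = h}
    rw [this]
    exact isClosed_iInter fun i => isClosed_iInter fun j =>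
      isClosed_eq (coord i).continuous (coord j).continuous

/-- `K × ⋯ × K` (`m` times). -/
def power (m : ℕ) (K : ClosedSubmodule ℝ H) : ClosedSubmodule ℝ (ProductSpace m H) :=
  subspaceC fun _ => K

theorem mem_subspaceC (M : Fin m → ClosedSubmodule ℝ H) (x : ProductSpace m H) :
    x ∈ subspaceC M ↔ ∀ i, x i ∈ M i := by
  simp [subspaceC]

theorem mem_diagonal (x : ProductSpace m H) :
    x ∈ diagonal m H ↔ ∃ h : H, ∀ i, x i = h := Iff.rfl

theorem mem_power (K : ClosedSubmodule ℝ H) (x : ProductSpace m H) :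
    x ∈ power m K ↔ ∀ i, x i ∈ K :=
  mem_subspaceC _ x

end ProductSpace

end

/-! Everything is measured by the loss `‖x‖² - ‖T x‖²`, whose sum along an orbit telescopes and
never exceeds `‖x‖²`. For a product of projections, `x - T x` is a sum of increments whose squared
lengths are the losses of the factors. Pairing an increment with `y` only sees `y - p y`, which the
loss of the adjoint controls. Hence `⟪x - T x, y⟫²` is at most a constant times the loss of `T` at
`x` times that of `T*` at `y` (`inner_sub_list_prod_sq_le_normLoss`).

Since `T^k (1 - T) = T^(k-j) (1 - T) T^j` for every `j ≤ k`, summing over `j` with Cauchy-Schwarz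
gives the rate `1/k` (`norm_pow_succ_sub_pow_le`). The loss at `T^k x` is at most `2 ‖T^k x -
T^(k+1) x‖ ‖x‖`, so an operator dominated by the loss gains `k^(-1/2)` on the left and, by
adjunction, on the right. Halving the exponent multiplies rates. In the product space, `P_D`
commutes with the cyclic product, and `P_(Cᗮ)` is dominated by the loss. -/

/-! ### Norm loss and the `1/k` rate for an abstract contraction. -/

section Operators

variable {E : Type*} [NormedAddCommGroup E] [InnerProductSpace ℝ E]

/-- The loss `‖x‖² - ‖T x‖²` of squared norm of `x` under the operator `T`. -/
def normLoss (T : E →L[ℝ] E) (x : E) : ℝ := ‖x‖ ^ 2 - ‖T x‖ ^ 2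

theorem normLoss_nonneg {T : E →L[ℝ] E} (hT : ‖T‖ ≤ 1) (x : E) : 0 ≤ normLoss T x := by
  have h := T.le_of_opNorm_le hT x
  rw [one_mul] at h
  exact sub_nonneg.2 (pow_le_pow_left₀ (norm_nonneg _) h 2)

/-- Difference of squares: one factor is at most `‖x - T x‖`, the other at most `2 ‖x‖`. -/
theorem normLoss_le {T : E →L[ℝ] E} (hT : ‖T‖ ≤ 1) (x : E) :
    normLoss T x ≤ 2 * ‖x - T x‖ * ‖x‖ := by
  have h := T.le_of_opNorm_le hT x
  rw [one_mul] at h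
  have h' : ‖x‖ - ‖T x‖ ≤ ‖x - T x‖ := norm_sub_norm_le _ _
  unfold normLoss
  nlinarith [norm_nonneg x, norm_nonneg (T x), norm_nonneg (x - T x)]

theorem norm_pow_apply_le {T : E →L[ℝ] E} (hT : ‖T‖ ≤ 1) (k : ℕ) (x : E) :
    ‖(T ^ k) x‖ ≤ ‖x‖ := by
  induction k with
  | zero => simp
  | succ k ih =>
    rw [pow_succ', mul_apply_eq_comp]
    exact (T.le_of_opNorm_le hT _).trans (by rwa [one_mul])

theorem sum_normLoss_pow_le (T : E →L[ℝ] E) (n : ℕ) (x : E) :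
    ∑ k ∈ Finset.range n, normLoss T ((T ^ k) x) ≤ ‖x‖ ^ 2 := by
  have h : ∀ k, normLoss T ((T ^ k) x) = ‖(T ^ k) x‖ ^ 2 - ‖(T ^ (k + 1)) x‖ ^ 2 := fun k => by
    simp [normLoss, pow_succ']
  simp only [h]
  rw [Finset.sum_range_sub']
  simp

theorem opNorm_le_of_abs_inner_le (A : E →L[ℝ] E) {c : ℝ} (hc : 0 ≤ c)
    (h : ∀ x y, |inner ℝ (A x) y| ≤ c * ‖x‖ * ‖y‖) : ‖A‖ ≤ c := by
  refine A.opNorm_le_bound hc fun x => ?_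
  have hx := h x (A x)
  rw [real_inner_self_eq_norm_sq, abs_of_nonneg (sq_nonneg _)] at hx
  rcases (norm_nonneg (A x)).eq_or_lt with h0 | h0
  · rw [← h0]; positivity
  · exact le_of_mul_le_mul_right (by linarith) h0

/-- If `‖B x‖²` is controlled by the norm loss of `T`, then `‖B * T ^ k‖` decays like the square
root of `‖T ^ (k + 1) - T ^ k‖`. -/
theorem norm_mul_pow_le {T B : E →L[ℝ] E} (hT : ‖T‖ ≤ 1) {K d : ℝ} (hK : 0 ≤ K)
    (hB : ∀ x, ‖B x‖ ^ 2 ≤ K * normLoss T x) (hd : 0 ≤ d) (k : ℕ)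
    (h : ‖T ^ (k + 1) - T ^ k‖ ≤ d) : ‖B * T ^ k‖ ≤ √(2 * K * d) := by
  refine ContinuousLinearMap.opNorm_le_bound _ (Real.sqrt_nonneg _) fun x => ?_
  refine abs_le_of_sq_le_sq' ?_ (by positivity) |>.2
  rw [mul_pow, Real.sq_sqrt (by positivity)]
  have h1 : ‖(T ^ k) x - T ((T ^ k) x)‖ ≤ d * ‖x‖ := by
    have := (T ^ (k + 1) - T ^ k).le_of_opNorm_le h x
    rw [norm_sub_rev]
    simpa [pow_succ'] using this
  have h2 : normLoss T ((T ^ k) x) ≤ 2 * (d * ‖x‖) * ‖x‖ :=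
    (normLoss_le hT _).trans (mul_le_mul (by linarith) (norm_pow_apply_le hT k x)
      (norm_nonneg _) (by positivity))
  calc ‖(B * T ^ k) x‖ ^ 2 ≤ K * normLoss T ((T ^ k) x) := hB _
    _ ≤ K * (2 * (d * ‖x‖) * ‖x‖) := mul_le_mul_of_nonneg_left h2 hK
    _ = 2 * K * d * ‖x‖ ^ 2 := by ring

theorem normLoss_cons (a : E →L[ℝ] E) (l : List (E →L[ℝ] E)) (x : E) :
    normLoss (a :: l).prod x = normLoss l.prod x + normLoss a (l.prod x) := by
  simp [normLoss]

variable [CompleteSpace E]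

/-- If the form `⟪(1 - T) x, y⟫` is controlled by the norm losses of `T` and of its adjoint, then
`‖T ^ k * (1 - T)‖` decays like `1 / k`. -/
theorem norm_pow_succ_sub_pow_le {T : E →L[ℝ] E} (hT : ‖T‖ ≤ 1) {c : ℝ}
    (h : ∀ x y, inner ℝ (x - T x) y ^ 2 ≤ c * (normLoss T x * normLoss (star T) y)) (k : ℕ) :
    ‖T ^ (k + 1) - T ^ k‖ ≤ √c / (k + 1) := by
  have hT' : ‖star T‖ ≤ 1 := (norm_star T).trans_le hT
  refine opNorm_le_of_abs_inner_le _ (by positivity) fun x y => ?_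
  -- The same number is bounded in `k + 1` ways, one for each place `j` at which `1 - T` is
  -- inserted; the leftover power `k - j` moves to `y` as an adjoint.
  have hterm : ∀ j ∈ Finset.range (k + 1),
      |inner ℝ ((T ^ (k + 1) - T ^ k) x) y| ≤
        √c * (√(normLoss T ((T ^ j) x)) *
          √(normLoss (star T) ((star T ^ (k + 1 - 1 - j)) y))) := fun j hj => by
    have hj' : k = (k - j) + j := by have := Finset.mem_range.1 hj; omega
    have e : inner ℝ ((T ^ (k + 1) - T ^ k) x) y =
        -inner ℝ ((T ^ j) x - T ((T ^ j) x)) ((star T ^ (k - j)) y) := by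
      rw [← star_pow, ContinuousLinearMap.star_eq_adjoint,
        ContinuousLinearMap.adjoint_inner_right, ← inner_neg_left]
      congr 1
      rw [← neg_sub (T ^ k), _root_.neg_apply, neg_inj]
      have hpow : T ^ k - T ^ (k + 1) = T ^ (k - j) * ((1 - T) * T ^ j) := by
        rw [sub_mul, one_mul, mul_sub, ← pow_succ', ← pow_add, ← pow_add, ← add_assoc, ← hj']
      rw [hpow]
      rfl
    rw [e, abs_neg, ← Real.sqrt_mul (normLoss_nonneg hT _), add_tsub_cancel_right]
    have h1 := Real.abs_le_sqrt (h ((T ^ j) x) ((star T ^ (k - j)) y))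
    rwa [Real.sqrt_mul' _ (mul_nonneg (normLoss_nonneg hT _) (normLoss_nonneg hT' _))] at h1
  have hsum := Finset.sum_le_sum hterm
  rw [Finset.sum_const, Finset.card_range, nsmul_eq_mul, ← Finset.mul_sum] at hsum
  have hcs := Real.sum_sqrt_mul_sqrt_le (Finset.range (k + 1))
    (f := fun j => normLoss T ((T ^ j) x))
    (g := fun j => normLoss (star T) ((star T ^ (k + 1 - 1 - j)) y))
    (fun j => normLoss_nonneg hT _) (fun j => normLoss_nonneg hT' _)
  rw [Finset.sum_range_reflect (fun j => normLoss (star T) ((star T ^ j) y))] at hcs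
  have h1 : √(∑ j ∈ Finset.range (k + 1), normLoss T ((T ^ j) x)) ≤ ‖x‖ :=
    Real.sqrt_le_iff.2 ⟨norm_nonneg _, sum_normLoss_pow_le T _ x⟩
  have h2 : √(∑ j ∈ Finset.range (k + 1), normLoss (star T) ((star T ^ j) y)) ≤ ‖y‖ :=
    Real.sqrt_le_iff.2 ⟨norm_nonneg _, sum_normLoss_pow_le _ _ y⟩
  have h3 := mul_le_mul h1 h2 (Real.sqrt_nonneg _) (norm_nonneg _)
  have h4 := hsum.trans (mul_le_mul_of_nonneg_left (hcs.trans h3) (Real.sqrt_nonneg c))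
  rw [Nat.cast_succ] at h4
  rw [div_mul_eq_mul_div, div_mul_eq_mul_div, le_div_iff₀ (by positivity)]
  linarith

/-! ### Loss estimates for products of projections. -/

theorem IsStarProjection.inner_apply_left {p : E →L[ℝ] E} (hp : IsStarProjection p) (x y : E) :
    inner ℝ (p x) y = inner ℝ x (p y) := by
  conv_lhs => rw [← hp.isSelfAdjoint.star_eq]
  rw [ContinuousLinearMap.star_eq_adjoint, ContinuousLinearMap.adjoint_inner_left]

theorem IsStarProjection.apply_apply {p : E →L[ℝ] E} (hp : IsStarProjection p) (x : E) :
    p (p x) = p x :=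
  DFunLike.congr_fun hp.isIdempotentElem.eq x

theorem IsStarProjection.inner_sub_left {p : E →L[ℝ] E} (hp : IsStarProjection p) (x y : E) :
    inner ℝ (x - p x) y = inner ℝ (x - p x) (y - p y) := by
  have := hp.inner_apply_left (x - p x) y
  rw [map_sub, hp.apply_apply, sub_self, inner_zero_left] at this
  rw [inner_sub_right, ← this, sub_zero]

theorem IsStarProjection.norm_sub_sq {p : E →L[ℝ] E} (hp : IsStarProjection p) (x : E) :
    ‖x - p x‖ ^ 2 = normLoss p x := by
  have h1 : inner ℝ x (p x) = ‖p x‖ ^ 2 := by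
    rw [← real_inner_self_eq_norm_sq, hp.inner_apply_left, hp.apply_apply]
  rw [normLoss, norm_sub_sq_real, h1]
  ring

theorem IsStarProjection.norm_le_one {p : E →L[ℝ] E} (hp : IsStarProjection p) : ‖p‖ ≤ 1 := by
  refine p.opNorm_le_bound zero_le_one fun x => ?_
  have h := hp.norm_sub_sq x
  rw [one_mul]
  refine abs_le_of_sq_le_sq' ?_ (norm_nonneg _) |>.2
  have := sq_nonneg ‖x - p x‖
  rw [h, normLoss] at this
  linarith

theorem norm_list_prod_le_one {l : List (E →L[ℝ] E)} (hl : ∀ p ∈ l, IsStarProjection p) :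
    ‖l.prod‖ ≤ 1 := by
  induction l with
  | nil => exact ContinuousLinearMap.norm_id_le
  | cons a l ih =>
    rw [List.prod_cons]
    exact (norm_mul_le _ _).trans (mul_le_one₀ (hl a (by simp)).norm_le_one (norm_nonneg _)
      (ih fun p hp => hl p (by simp [hp])))

theorem star_list_prod {l : List (E →L[ℝ] E)} (hl : ∀ p ∈ l, IsStarProjection p) :
    star l.prod = l.reverse.prod := by
  induction l with
  | nil => simp
  | cons a l ih =>
    rw [List.prod_cons, star_mul, ih fun p hp => hl p (by simp [hp]),
      (hl a (by simp)).isSelfAdjoint.star_eq]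
    simp

/-- Induction step for the list estimates: by `(s + t)² ≤ 2 s² + 2 t²`, each further factor doubles
the constant. -/
theorem add_sq_le_two_pow_succ_mul {s t A B : ℝ} (n : ℕ) (hB : 0 ≤ B) (hs : s ^ 2 ≤ 2 ^ n * A)
    (ht : t ^ 2 ≤ B) : (s + t) ^ 2 ≤ 2 ^ (n + 1) * (A + B) := by
  have h1 : (1 : ℝ) ≤ 2 ^ n := one_le_pow₀ one_le_two
  have h2 := mul_le_mul_of_nonneg_right h1 hB
  have h3 := sq_nonneg (s - t)
  rw [pow_succ (2 : ℝ)]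
  linarith

theorem norm_sub_list_prod_sq_le {l : List (E →L[ℝ] E)} (hl : ∀ p ∈ l, IsStarProjection p)
    (x : E) : ‖x - l.prod x‖ ^ 2 ≤ 2 ^ l.length * normLoss l.prod x := by
  induction l with
  | nil => simp [normLoss]
  | cons a l ih =>
    have ha := hl a (by simp)
    have h := add_sq_le_two_pow_succ_mul _ (normLoss_nonneg ha.norm_le_one (l.prod x))
      (ih fun p hp => hl p (by simp [hp])) (ha.norm_sub_sq (l.prod x)).le
    rw [normLoss_cons, List.length_cons]
    refine le_trans (pow_le_pow_left₀ (norm_nonneg _) ?_ 2) h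
    rw [List.prod_cons, mul_apply_eq_comp]
    exact norm_sub_le_norm_sub_add_norm_sub _ _ _

theorem norm_sub_apply_sq_le_of_mem {l : List (E →L[ℝ] E)} (hl : ∀ p ∈ l, IsStarProjection p)
    {p : E →L[ℝ] E} (hp : p ∈ l) (x : E) :
    ‖x - p x‖ ^ 2 ≤ 2 ^ l.length * normLoss l.prod x := by
  induction l with
  | nil => simp at hp
  | cons a l ih =>
    have ha := hl a (by simp)
    rcases List.mem_cons.1 hp with rfl | hp'
    -- The head is applied last, so `1 - p` kills the product and `x - p x = (1 - p) (x - T x)`.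
    · refine le_trans (pow_le_pow_left₀ (norm_nonneg _) ?_ 2) (norm_sub_list_prod_sq_le hl x)
      have h := (hl p hp).one_sub.norm_le_one
      have h' := (1 - p).le_of_opNorm_le h (x - (p :: l).prod x)
      simpa [ha.apply_apply] using h'
    · have hl' : ∀ p ∈ l, IsStarProjection p := fun p hp => hl p (by simp [hp])
      refine (ih hl' hp').trans ?_
      rw [normLoss_cons, List.length_cons, pow_succ]
      have h1 := normLoss_nonneg (norm_list_prod_le_one hl') x
      have h2 := normLoss_nonneg ha.norm_le_one (l.prod x)
      have h3 : (0 : ℝ) < 2 ^ l.length := by positivity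
      nlinarith [mul_nonneg h3.le h1, mul_nonneg h3.le h2]

/-- Each increment `z - p z` is orthogonal to the range of `p`, so `y` may be replaced by `y - p y`
before Cauchy-Schwarz. -/
theorem inner_sub_list_prod_sq_le {l : List (E →L[ℝ] E)} (hl : ∀ p ∈ l, IsStarProjection p)
    (x y : E) {K : ℝ} (hK : 0 ≤ K) (hy : ∀ p ∈ l, ‖y - p y‖ ^ 2 ≤ K) :
    inner ℝ (x - l.prod x) y ^ 2 ≤ 2 ^ l.length * (normLoss l.prod x * K) := by
  induction l with
  | nil => simp [normLoss]
  | cons a l ih =>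
    have ha := hl a (by simp)
    have hz := normLoss_nonneg ha.norm_le_one (l.prod x)
    have ht : inner ℝ (l.prod x - a (l.prod x)) y ^ 2 ≤ normLoss a (l.prod x) * K := by
      rw [ha.inner_sub_left, ← ha.norm_sub_sq, ← sq_abs]
      refine (pow_le_pow_left₀ (abs_nonneg _) (abs_real_inner_le_norm _ _) 2).trans ?_
      rw [mul_pow]
      exact mul_le_mul_of_nonneg_left (hy a (by simp)) (sq_nonneg _)
    have h := add_sq_le_two_pow_succ_mul _ (mul_nonneg hz hK)
      (ih (fun p hp => hl p (by simp [hp])) fun p hp => hy p (by simp [hp])) ht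
    rw [normLoss_cons, List.length_cons, add_mul]
    refine le_trans (le_of_eq ?_) h
    rw [← inner_add_left, List.prod_cons, mul_apply_eq_comp, sub_add_sub_cancel]

theorem inner_sub_list_prod_sq_le_normLoss {l : List (E →L[ℝ] E)}
    (hl : ∀ p ∈ l, IsStarProjection p) (x y : E) :
    inner ℝ (x - l.prod x) y ^ 2 ≤
      (2 ^ l.length * 2 ^ l.length) * (normLoss l.prod x * normLoss (star l.prod) y) := by
  have hl' : ∀ p ∈ l.reverse, IsStarProjection p := fun p hp => hl p (by simpa using hp)
  -- The adjoint is the product of the reversed list, which has the same factors, so its loss bounds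
  -- every `‖y - p y‖²`.
  have h := inner_sub_list_prod_sq_le hl x y
    (K := 2 ^ l.length * normLoss (star l.prod) y)
    (mul_nonneg (by positivity)
      (normLoss_nonneg ((norm_star _).trans_le (norm_list_prod_le_one hl)) _))
    fun p hp => by
      rw [star_list_prod hl, ← List.length_reverse]
      exact norm_sub_apply_sq_le_of_mem hl' (by simpa using hp) y
  linarith

end Operators

/-! ### Asymptotic rates. -/

section Rates

theorem isBigO_comp_of_le_four_mul {X : ℕ → ℝ} {r : ℝ} (hr : r ≤ 0)
    (hX : X =O[atTop] fun k : ℕ => (k : ℝ) ^ r) {g : ℕ → ℕ} (hg : ∀ k, 2 ≤ k → k ≤ 4 * g k) :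
    (fun k => X (g k)) =O[atTop] fun k : ℕ => (k : ℝ) ^ r := by
  have hlim : Tendsto g atTop atTop := by
    refine tendsto_atTop.2 fun b => ?_
    filter_upwards [eventually_ge_atTop (4 * b + 2)] with k hk
    have := hg k (by omega)
    omega
  refine (hX.comp_tendsto hlim).trans (IsBigO.of_bound ((4 : ℝ) ^ (-r)) ?_)
  filter_upwards [eventually_ge_atTop 2] with k hk
  have hk0 : (0 : ℝ) < k := by exact_mod_cast (by omega : 0 < k)
  have h1 : (k : ℝ) / 4 ≤ g k := by
    rw [div_le_iff₀ (by norm_num)]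
    exact_mod_cast (hg k hk).trans_eq (mul_comm _ _)
  have h2 : (0 : ℝ) < k / 4 := by positivity
  rw [Function.comp_apply, Real.norm_of_nonneg (by positivity), Real.norm_of_nonneg (by positivity)]
  refine (Real.rpow_le_rpow_of_nonpos h2 h1 hr).trans_eq ?_
  rw [Real.div_rpow hk0.le (by norm_num), Real.rpow_neg (by norm_num)]
  ring

/-- Rates multiply along a splitting of the exponent into two halves. -/
theorem isBigO_of_norm_add_le {Z X Y : ℕ → ℝ} {r s t : ℝ} (hr : r ≤ 0) (hs : s ≤ 0)
    (hX : X =O[atTop] fun k : ℕ => (k : ℝ) ^ r) (hY : Y =O[atTop] fun k : ℕ => (k : ℝ) ^ s)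
    (hZ : ∀ a b, 1 ≤ a → ‖Z (a + b)‖ ≤ X a * Y b) (ht : r + s = t) :
    Z =O[atTop] fun k : ℕ => (k : ℝ) ^ t := by
  -- The larger half goes to `X`, so that it is positive as soon as `k` is; differences `T^a -
  -- T^(a-1)` need `1 ≤ a`.
  have hX' := isBigO_comp_of_le_four_mul hr hX (g := fun k => k - k / 2) fun k hk => by omega
  have hY' := isBigO_comp_of_le_four_mul hs hY (g := fun k => k / 2) fun k hk => by omega
  have h1 : Z =O[atTop] fun k => X (k - k / 2) * Y (k / 2) := by
    refine IsBigO.of_bound 1 ?_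
    filter_upwards [eventually_ge_atTop 1] with k hk
    have := hZ (k - k / 2) (k / 2) (by omega)
    rw [Nat.sub_add_cancel (Nat.div_le_self k 2)] at this
    rw [one_mul]
    exact this.trans (le_abs_self _)
  refine (h1.trans (hX'.mul hY')).congr' EventuallyEq.rfl ?_
  filter_upwards [eventually_ge_atTop 1] with k hk
  rw [← ht, Real.rpow_add (by exact_mod_cast hk)]

theorem isBigO_iSup {ι : Type*} [Fintype ι] {f : ι → ℕ → ℝ} {g : ℕ → ℝ}
    (hf : ∀ i k, 0 ≤ f i k) (h : ∀ i, f i =O[atTop] g) :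
    (fun k => ⨆ i, f i k) =O[atTop] g := by
  have hsum : (fun k => ∑ i, f i k) =O[atTop] g := by
    simpa [Finset.sum_fn] using IsBigO.sum (s := Finset.univ) fun i _ => h i
  refine (IsBigO.of_bound 1 (Eventually.of_forall fun k => ?_)).trans hsum
  rw [one_mul, Real.norm_of_nonneg (Real.iSup_nonneg fun i => hf i k),
    Real.norm_of_nonneg (Finset.sum_nonneg fun i _ => hf i k)]
  exact Real.iSup_le (fun i => Finset.single_le_sum (f := fun i => f i k) (fun j _ => hf j k)
    (Finset.mem_univ i)) (Finset.sum_nonneg fun i _ => hf i k)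

variable {E : Type*} [NormedAddCommGroup E] [InnerProductSpace ℝ E] [CompleteSpace E]

theorem isBigO_norm_pow_sub_pow {l : List (E →L[ℝ] E)} (hl : ∀ p ∈ l, IsStarProjection p) :
    (fun k : ℕ => ‖l.prod ^ k - l.prod ^ (k - 1)‖) =O[atTop] fun k : ℕ => (k : ℝ) ^ (-1 : ℝ) := by
  refine IsBigO.of_bound (√(2 ^ l.length * 2 ^ l.length)) ?_
  filter_upwards [eventually_ge_atTop 1] with k hk
  obtain ⟨k, rfl⟩ := Nat.exists_eq_add_of_le' hk
  have h := norm_pow_succ_sub_pow_le (norm_list_prod_le_one hl)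
    (inner_sub_list_prod_sq_le_normLoss hl) k
  rw [norm_norm, Real.rpow_neg_one, Real.norm_of_nonneg (by positivity)]
  rwa [Nat.cast_succ, add_tsub_cancel_right, ← div_eq_mul_inv]

theorem isBigO_norm_mul_pow {l : List (E →L[ℝ] E)} (hl : ∀ p ∈ l, IsStarProjection p)
    {B : E →L[ℝ] E} {K : ℝ} (hK : 0 ≤ K) (hB : ∀ x, ‖B x‖ ^ 2 ≤ K * normLoss l.prod x) :
    (fun k : ℕ => ‖B * l.prod ^ k‖) =O[atTop] fun k : ℕ => (k : ℝ) ^ (-1 / 2 : ℝ) := by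
  set c : ℝ := √(2 ^ l.length * 2 ^ l.length)
  refine IsBigO.of_bound (√(2 * K * c)) ?_
  filter_upwards [eventually_ge_atTop 1] with k hk
  have hk0 : (0 : ℝ) < k := by exact_mod_cast hk
  have h := norm_mul_pow_le (norm_list_prod_le_one hl) hK hB (by positivity) k
    (norm_pow_succ_sub_pow_le (norm_list_prod_le_one hl) (inner_sub_list_prod_sq_le_normLoss hl) k)
  rw [norm_norm, Real.norm_of_nonneg (by positivity)]
  refine h.trans ?_
  have e : (k : ℝ) ^ (-1 / 2 : ℝ) = √((k : ℝ)⁻¹) := by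
    rw [Real.sqrt_eq_rpow, Real.inv_rpow hk0.le, ← Real.rpow_neg hk0.le]
    norm_num
  rw [e, ← Real.sqrt_mul (by positivity)]
  refine Real.sqrt_le_sqrt ?_
  rw [mul_assoc (2 * K), ← div_eq_mul_inv]
  gcongr
  linarith

theorem isBigO_norm_pow_mul {l : List (E →L[ℝ] E)} (hl : ∀ p ∈ l, IsStarProjection p)
    {B : E →L[ℝ] E} (hsa : IsSelfAdjoint B) {K : ℝ} (hK : 0 ≤ K)
    (hB : ∀ x, ‖B x‖ ^ 2 ≤ K * normLoss l.reverse.prod x) :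
    (fun k : ℕ => ‖l.prod ^ k * B‖) =O[atTop] fun k : ℕ => (k : ℝ) ^ (-1 / 2 : ℝ) := by
  have h := isBigO_norm_mul_pow (l := l.reverse) (fun p hp => hl p (by simpa using hp)) hK hB
  refine h.congr_left fun k => ?_
  rw [← star_list_prod hl, ← norm_star, star_mul, star_pow, star_star, hsa.star_eq]

/-- Split as `(T^a - T^(a-1)) (T^b B)`, with rates `-1` and `-1/2`. -/
theorem isBigO_norm_pow_sub_pow_mul {l : List (E →L[ℝ] E)} (hl : ∀ p ∈ l, IsStarProjection p)
    {B : E →L[ℝ] E} (hsa : IsSelfAdjoint B) {K : ℝ} (hK : 0 ≤ K)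
    (hB : ∀ x, ‖B x‖ ^ 2 ≤ K * normLoss l.reverse.prod x) :
    (fun k : ℕ => ‖(l.prod ^ k - l.prod ^ (k - 1)) * B‖) =O[atTop]
      fun k : ℕ => (k : ℝ) ^ (-3 / 2 : ℝ) := by
  refine isBigO_of_norm_add_le (by norm_num) (by norm_num) (isBigO_norm_pow_sub_pow hl)
    (isBigO_norm_pow_mul hl hsa hK hB) (fun a b ha => ?_) (by norm_num)
  rw [norm_norm]
  refine le_trans (le_of_eq ?_) (norm_mul_le _ _)
  rw [← mul_assoc, sub_mul (l.prod ^ a), ← pow_add, ← pow_add, Nat.sub_add_comm ha]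

theorem isBigO_norm_mul_pow_mul {l : List (E →L[ℝ] E)} (hl : ∀ p ∈ l, IsStarProjection p)
    {A B : E →L[ℝ] E} (hsa : IsSelfAdjoint B) {K : ℝ} (hK : 0 ≤ K)
    (hA : ∀ x, ‖A x‖ ^ 2 ≤ K * normLoss l.prod x)
    (hB : ∀ x, ‖B x‖ ^ 2 ≤ K * normLoss l.reverse.prod x) :
    (fun k : ℕ => ‖A * l.prod ^ k * B‖) =O[atTop] fun k : ℕ => (k : ℝ) ^ (-1 : ℝ) := by
  refine isBigO_of_norm_add_le (by norm_num) (by norm_num) (isBigO_norm_mul_pow hl hK hA)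
    (isBigO_norm_pow_mul hl hsa hK hB) (fun a b _ => ?_) (by norm_num)
  rw [norm_norm]
  refine le_trans (le_of_eq ?_) (norm_mul_le _ _)
  simp only [pow_add, mul_assoc]

end Rates

/-! ### Orthogonal projections onto closed subspaces. -/

section Projections

variable {E : Type*} [NormedAddCommGroup E] [InnerProductSpace ℝ E] [CompleteSpace E]

theorem isStarProjection_orthProj (K : ClosedSubmodule ℝ E) : IsStarProjection (orthProj K) :=
  isStarProjection_starProjection

theorem orthProj_orthogonal (K : ClosedSubmodule ℝ E) : orthProj Kᗮ = 1 - orthProj K :=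
  Submodule.starProjection_orthogonal' K.toSubmodule

theorem orthProj_orthogonal_apply (K : ClosedSubmodule ℝ E) (x : E) :
    orthProj Kᗮ x = x - orthProj K x := by
  rw [orthProj_orthogonal]
  rfl

theorem orthProj_mem (K : ClosedSubmodule ℝ E) (x : E) : orthProj K x ∈ K :=
  K.toSubmodule.starProjection_apply_mem x

theorem orthProj_apply_of_mem {K : ClosedSubmodule ℝ E} {x : E} (hx : x ∈ K) :
    orthProj K x = x :=
  Submodule.starProjection_eq_self_iff.2 hx

theorem norm_orthProj_orthogonal_le (K : ClosedSubmodule ℝ E) {y : E} (hy : y ∈ K) (x : E) :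
    ‖orthProj Kᗮ x‖ ≤ ‖x - y‖ := by
  have h := (orthProj Kᗮ).le_of_opNorm_le (isStarProjection_orthProj _).norm_le_one (x - y)
  have h0 : orthProj Kᗮ y = 0 := by
    rw [orthProj_orthogonal_apply, orthProj_apply_of_mem hy, sub_self]
  rwa [map_sub, h0, sub_zero, one_mul] at h

theorem isStarProjection_of_mem_ofFn {m : ℕ} (M : Fin m → ClosedSubmodule ℝ E) :
    ∀ p ∈ (List.ofFn fun i => orthProj (M i)).reverse, IsStarProjection p := by
  intro p hp
  obtain ⟨i, rfl⟩ := List.mem_ofFn.1 (List.mem_reverse.1 hp)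
  exact isStarProjection_orthProj _

theorem norm_orthProj_orthogonal_sq_le_of_mem {l : List (E →L[ℝ] E)}
    (hl : ∀ p ∈ l, IsStarProjection p) {K : ClosedSubmodule ℝ E} (hK : orthProj K ∈ l) (x : E) :
    ‖orthProj Kᗮ x‖ ^ 2 ≤ 2 ^ l.length * normLoss l.prod x := by
  rw [orthProj_orthogonal]
  exact norm_sub_apply_sq_le_of_mem hl hK x

/-- An orthogonal projection leaving a closed subspace invariant commutes with the orthogonal
projection onto that subspace. -/
theorem commute_orthProj_of_forall_mem {p : E →L[ℝ] E} (hp : IsStarProjection p)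
    {K : ClosedSubmodule ℝ E} (h : ∀ x ∈ K, p x ∈ K) : Commute p (orthProj K) := by
  have h1 : orthProj K * p * orthProj K = p * orthProj K := by
    ext x
    exact orthProj_apply_of_mem (h _ (orthProj_mem K x))
  -- The left side of `h1` is self-adjoint, hence so is `p P_K`, which is commutation.
  have h2 := congrArg star h1
  rw [star_mul, star_mul, star_mul, hp.isSelfAdjoint.star_eq,
    (isStarProjection_orthProj K).isSelfAdjoint.star_eq, ← mul_assoc, h1] at h2
  exact h2

end Projections

/-! ### Pierra's product space. -/

namespace ProductSpace

variable {m : ℕ} {H : Type*} [NormedAddCommGroup H] [InnerProductSpace ℝ H]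

theorem norm_sq (x : ProductSpace m H) : ‖x‖ ^ 2 = (1 / (m : ℝ)) * ∑ i, ‖x i‖ ^ 2 := by
  rw [norm_def, Real.sq_sqrt]
  positivity

variable [CompleteSpace H]

/-- If all the distances from `x` to the powers of `M_i` are small, then so is the distance from
`x` to `M_1 × ⋯ × M_m`. -/
theorem norm_orthProj_subspaceC_orthogonal_sq_le (M : Fin m → ClosedSubmodule ℝ H)
    (x : ProductSpace m H) {δ : ℝ} (hδ : 0 ≤ δ)
    (h : ∀ i, ‖orthProj (power m (M i))ᗮ x‖ ^ 2 ≤ δ) :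
    ‖orthProj (subspaceC M)ᗮ x‖ ^ 2 ≤ m * δ := by
  -- A competitor in `C`: its `i`-th coordinate is taken from the projection onto the `i`-th power,
  -- so `x - c` agrees there with the `i`-th residual. The weight `1/m` makes reading off a
  -- coordinate cost `√m`.
  let c : ProductSpace m H := fun i => orthProj (power m (M i)) x i
  have hc : c ∈ subspaceC M := (mem_subspaceC M c).2 fun i =>
    (mem_power (M i) _).1 (orthProj_mem _ x) i
  refine (pow_le_pow_left₀ (norm_nonneg _) (norm_orthProj_orthogonal_le _ hc x) 2).trans ?_
  have hi : ∀ i ∈ Finset.univ, ‖(x - c) i‖ ^ 2 ≤ m * δ := fun i _ => by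
    have h1 := norm_apply_le (orthProj (power m (M i))ᗮ x) i
    have h2 : (x - c) i = orthProj (power m (M i))ᗮ x i := by
      rw [orthProj_orthogonal_apply, sub_apply, sub_apply]
    rw [h2]
    refine (pow_le_pow_left₀ (norm_nonneg _) h1 2).trans ?_
    rw [mul_pow, Real.sq_sqrt (Nat.cast_nonneg m)]
    exact mul_le_mul_of_nonneg_left (h i) (Nat.cast_nonneg m)
  have hs := Finset.sum_le_sum hi
  rw [Finset.sum_const, Finset.card_univ, Fintype.card_fin, nsmul_eq_mul] at hs
  rw [norm_sq]
  refine (mul_le_mul_of_nonneg_left hs (by positivity)).trans ?_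
  rw [← mul_assoc]
  exact mul_le_of_le_one_left (by positivity) (by rw [one_div]; exact inv_mul_le_one)

theorem norm_orthProj_subspaceC_orthogonal_sq_le_normLoss (M : Fin m → ClosedSubmodule ℝ H)
    {l : List (ProductSpace m H →L[ℝ] ProductSpace m H)} (hl : ∀ p ∈ l, IsStarProjection p)
    (hM : ∀ i, orthProj (power m (M i)) ∈ l) (x : ProductSpace m H) :
    ‖orthProj (subspaceC M)ᗮ x‖ ^ 2 ≤ (m * 2 ^ l.length) * normLoss l.prod x := by
  rw [mul_assoc]
  exact norm_orthProj_subspaceC_orthogonal_sq_le M x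
    (mul_nonneg (by positivity) (normLoss_nonneg (norm_list_prod_le_one hl) x))
    fun i => norm_orthProj_orthogonal_sq_le_of_mem hl (hM i) x

theorem orthProj_power_apply_of_forall_eq (K : ClosedSubmodule ℝ H) {x : ProductSpace m H} {h : H}
    (hx : ∀ i, x i = h) (i : Fin m) : orthProj (power m K) x i = orthProj K h := by
  let v : ProductSpace m H := fun _ => orthProj K h
  have hv : orthProj (power m K) x = v := by
    refine Submodule.eq_starProjection_of_mem_of_inner_eq_zero (𝕜 := ℝ)
      ((mem_power K v).2 fun _ => orthProj_mem K h) (fun w hw => ?_) |>.symm ▸ rfl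
    rw [inner_def]
    refine mul_eq_zero_of_right _ (Finset.sum_eq_zero fun j _ => ?_)
    rw [sub_apply, hx]
    exact K.toSubmodule.starProjection_inner_eq_zero h _ ((mem_power K w).1 hw j)
  rw [hv]

theorem commute_cyclicProduct_power_diagonal (M : Fin m → ClosedSubmodule ℝ H) :
    Commute (cyclicProduct fun i => power m (M i)) (orthProj (diagonal m H)) := by
  refine Commute.list_prod_left _ _ fun p hp => ?_
  obtain ⟨i, rfl⟩ := List.mem_ofFn.1 (List.mem_reverse.1 hp)
  refine commute_orthProj_of_forall_mem (isStarProjection_orthProj _) fun x ⟨h, hx⟩ => ?_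
  exact ⟨_, orthProj_power_apply_of_forall_eq (M i) hx⟩

end ProductSpace

/-! ### Assembly of the ten rates. -/

theorem Asymptotics.IsBigO.norm_mul_orthProj {E : Type*} [NormedAddCommGroup E]
    [InnerProductSpace ℝ E] [CompleteSpace E] {A : ℕ → E →L[ℝ] E} {g : ℕ → ℝ}
    (h : (fun k => ‖A k‖) =O[atTop] g) {p : E →L[ℝ] E} (hp : IsStarProjection p) :
    (fun k => ‖A k * p‖) =O[atTop] g := by
  refine (IsBigO.of_bound 1 (Eventually.of_forall fun k => ?_)).trans h
  rw [_root_.norm_norm, _root_.norm_norm, one_mul]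
  exact (norm_mul_le _ _).trans (mul_le_of_le_one_right (norm_nonneg _) hp.norm_le_one)

theorem Asymptotics.IsBigO.norm_orthProj_mul {E : Type*} [NormedAddCommGroup E]
    [InnerProductSpace ℝ E] [CompleteSpace E] {A : ℕ → E →L[ℝ] E} {g : ℕ → ℝ}
    (h : (fun k => ‖A k‖) =O[atTop] g) {p : E →L[ℝ] E} (hp : IsStarProjection p) :
    (fun k => ‖p * A k‖) =O[atTop] g := by
  refine (IsBigO.of_bound 1 (Eventually.of_forall fun k => ?_)).trans h
  rw [_root_.norm_norm, _root_.norm_norm, one_mul]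
  exact (norm_mul_le _ _).trans (mul_le_of_le_one_left (norm_nonneg _) hp.norm_le_one)

theorem lemma4p1 {H : Type*} [NormedAddCommGroup H] [InnerProductSpace ℝ H] [CompleteSpace H]
    {m : ℕ} (hm : 1 ≤ m) (M : Fin m → ClosedSubmodule ℝ H) :
    let T : H →L[ℝ] H := cyclicProduct M
    let P : Fin m → (H →L[ℝ] H) := fun i => orthProj (M i)ᗮ
    let T' : ProductSpace m H →L[ℝ] ProductSpace m H :=
      cyclicProduct fun i => ProductSpace.power m (M i)
    let PD : ProductSpace m H →L[ℝ] ProductSpace m H := orthProj (ProductSpace.diagonal m H)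
    let PC : ProductSpace m H →L[ℝ] ProductSpace m H := orthProj (ProductSpace.subspaceC M)ᗮ
    ((fun k : ℕ => ‖T ^ k - T ^ (k - 1)‖) =O[atTop] fun k : ℕ => (k : ℝ) ^ (-1 : ℝ)) ∧
    ((fun k : ℕ => ⨆ i, ‖P i * T ^ k‖) =O[atTop] fun k : ℕ => (k : ℝ) ^ (-1 / 2 : ℝ)) ∧
    ((fun k : ℕ => ⨆ i, ‖T ^ k * P i‖) =O[atTop] fun k : ℕ => (k : ℝ) ^ (-1 / 2 : ℝ)) ∧
    ((fun k : ℕ => ⨆ i, ‖(T ^ k - T ^ (k - 1)) * P i‖) =O[atTop]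
      fun k : ℕ => (k : ℝ) ^ (-3 / 2 : ℝ)) ∧
    ((fun k : ℕ => ⨆ ij : Fin m × Fin m, ‖P ij.1 * T ^ k * P ij.2‖) =O[atTop]
      fun k : ℕ => (k : ℝ) ^ (-1 : ℝ)) ∧
    ((fun k : ℕ => ‖(T' ^ k - T' ^ (k - 1)) * PD‖) =O[atTop]
      fun k : ℕ => (k : ℝ) ^ (-1 : ℝ)) ∧
    ((fun k : ℕ => ‖PC * T' ^ k * PD‖) =O[atTop] fun k : ℕ => (k : ℝ) ^ (-1 / 2 : ℝ)) ∧
    ((fun k : ℕ => ‖T' ^ k * PD * PC‖) =O[atTop] fun k : ℕ => (k : ℝ) ^ (-1 / 2 : ℝ)) ∧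
    ((fun k : ℕ => ‖(T' ^ k - T' ^ (k - 1)) * PD * PC‖) =O[atTop]
      fun k : ℕ => (k : ℝ) ^ (-3 / 2 : ℝ)) ∧
    ((fun k : ℕ => ‖PC * T' ^ k * PD * PC‖) =O[atTop] fun k : ℕ => (k : ℝ) ^ (-1 : ℝ)) := by
  intro T P T' PD PC
  have hl := isStarProjection_of_mem_ofFn M
  have hl' := isStarProjection_of_mem_ofFn fun i => ProductSpace.power m (M i)
  set l := (List.ofFn fun i => orthProj (M i)).reverse with hl_def
  set l' := (List.ofFn fun i => orthProj (ProductSpace.power m (M i))).reverse with hl'_def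
  have hPsa : ∀ i, IsSelfAdjoint (P i) := fun i => (isStarProjection_orthProj _).isSelfAdjoint
  have hPCsa : IsSelfAdjoint PC := (isStarProjection_orthProj _).isSelfAdjoint
  have hPD : IsStarProjection PD := isStarProjection_orthProj _
  have hmem : ∀ i, orthProj (M i) ∈ l := fun i => by simp [hl_def]
  have hmem' : ∀ i, orthProj (ProductSpace.power m (M i)) ∈ l' := fun i => by
    rw [hl'_def, List.mem_reverse]
    exact List.mem_ofFn.2 ⟨i, rfl⟩
  have hP : ∀ i x, ‖P i x‖ ^ 2 ≤ 2 ^ l.length * normLoss l.prod x := fun i x =>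
    norm_orthProj_orthogonal_sq_le_of_mem hl (hmem i) x
  have hP' : ∀ i x, ‖P i x‖ ^ 2 ≤ 2 ^ l.length * normLoss l.reverse.prod x := fun i x => by
    rw [← List.length_reverse]
    exact norm_orthProj_orthogonal_sq_le_of_mem (fun p hp => hl p (List.mem_reverse.1 hp))
      (List.mem_reverse.2 (hmem i)) x
  have hC : ∀ x, ‖PC x‖ ^ 2 ≤ (m * 2 ^ l'.length) * normLoss l'.prod x := fun x =>
    ProductSpace.norm_orthProj_subspaceC_orthogonal_sq_le_normLoss M hl' hmem' x
  have hC' : ∀ x, ‖PC x‖ ^ 2 ≤ (m * 2 ^ l'.length) * normLoss l'.reverse.prod x := fun x => by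
    rw [← List.length_reverse]
    exact ProductSpace.norm_orthProj_subspaceC_orthogonal_sq_le_normLoss M
      (fun p hp => hl' p (List.mem_reverse.1 hp)) (fun i => List.mem_reverse.2 (hmem' i)) x
  have hK : (0 : ℝ) ≤ 2 ^ l.length := by positivity
  have hK' : (0 : ℝ) ≤ m * 2 ^ l'.length := by positivity
  have hcomm : Commute T' PD := ProductSpace.commute_cyclicProduct_power_diagonal M
  have hpow : ∀ k, T' ^ k * PD = PD * T' ^ k := fun k => (hcomm.pow_left k).eq
  refine ⟨isBigO_norm_pow_sub_pow hl, ?_, ?_, ?_, ?_, ?_, ?_, ?_, ?_, ?_⟩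
  · exact isBigO_iSup (fun _ _ => norm_nonneg _) fun i => isBigO_norm_mul_pow hl hK (hP i)
  · exact isBigO_iSup (fun _ _ => norm_nonneg _) fun i =>
      isBigO_norm_pow_mul hl (hPsa i) hK (hP' i)
  · exact isBigO_iSup (fun _ _ => norm_nonneg _) fun i =>
      isBigO_norm_pow_sub_pow_mul hl (hPsa i) hK (hP' i)
  · exact isBigO_iSup (fun _ _ => norm_nonneg _) fun ij =>
      isBigO_norm_mul_pow_mul hl (hPsa ij.2) hK (hP ij.1) (hP' ij.2)
  · exact (isBigO_norm_pow_sub_pow hl').norm_mul_orthProj hPD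
  · exact (isBigO_norm_mul_pow hl' hK' hC).norm_mul_orthProj hPD
  · simp only [hpow, mul_assoc]
    exact (isBigO_norm_pow_mul hl' hPCsa hK' hC').norm_orthProj_mul hPD
  · simp only [sub_mul, hpow]
    simp only [← mul_sub, ← sub_mul, mul_assoc]
    exact (isBigO_norm_pow_sub_pow_mul hl' hPCsa hK' hC').norm_orthProj_mul hPD
  -- Commuting `P_D` into the middle gives `(P_(Cᗮ) T'^a P_D) (T'^b P_(Cᗮ))`, each factor of rate
  -- `-1/2`.
  · have hXD := (isBigO_norm_mul_pow hl' hK' hC).norm_mul_orthProj hPD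
    refine isBigO_of_norm_add_le (by norm_num) (by norm_num) hXD
      (isBigO_norm_pow_mul hl' hPCsa hK' hC') (fun a b _ => ?_) (by norm_num)
    refine (norm_norm (PC * T' ^ (a + b) * PD * PC)).trans_le
      (le_trans (le_of_eq ?_) (norm_mul_le _ _))
    change ‖PC * T' ^ (a + b) * PD * PC‖ = ‖PC * T' ^ a * PD * (T' ^ b * PC)‖
    rw [pow_add, mul_assoc, mul_assoc, mul_assoc, ← mul_assoc (T' ^ b), hpow]
    simp only [mul_assoc]
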